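/- Let $B$ be a unital C*-algebra acting faithfully on a complex Hilbert space $H$, so that $B$ is a norm-closed selfadjoint subalgebra of $B(H)$ having an identity element $1$ (which need not be the identity operator of $H$). Let $\mathfrak B\subseteq B(H)$ be the closure of $B$ in the weak* (ultraweak) topology of $B(H)$, and let $Z(\mathfrak B)$ be its center. Write $[u,v]=uv-vu$, let $\rho(u)$ denote the spectral radius of $u\in B$, and call an ideal of $B$ primitive if it is the annihilator of a simple left $B$-module. Let $a,b\in B$ be selfadjoint. The following conditions are equivalent: 1. $\rho([a,x])=\rho([b,x])$ for every $x\in B$. 2. $\|[a,x]\|=\|[b,x]\|$ for every selfadjoint $x\in B$. 3. For every primitive ideal $P$ of $B$, there is $\mu\in\mathbb C$ with $a+b-\mu 1\in P$, or there is $\mu\in\mathbb C$ with $a-b-\mu 1\in P$. 4. There are $c,z\in Z(\mathfrak B)$ with $c=c^*$, $z=z^*$ and $c^2=1$ such that $b=ca+z$. -/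

import Mathlib

/-- An ideal `P` of a ring `R` is (left) primitive if it is the annihilator of a simple left
`R`-module (an annihilator is automatically two-sided). As every simple module is isomorphic to a
quotient of `R` by a maximal left ideal, it is enough to let the module range over the universe
of `R`. -/
def IsPrimitiveIdeal.{u} {R : Type u} [Ring R] (P : Ideal R) : Prop :=
  ∃ (M : Type u) (_ : AddCommGroup M) (_ : Module R M),
    IsSimpleModule R M ∧ P = Module.annihilator R M

/-- The weak* topology on the bounded operators of a Hilbert space `H`, as the dual of the trace
class operators (also called the ultraweak or σ-weak topology). The weak* continuous functionals
are `T ↦ ∑ₙ ⟪ηₙ, T ξₙ⟫` with `∑ₙ ‖ξₙ‖² < ∞` and `∑ₙ ‖ηₙ‖² < ∞` (these series converge absolutely),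
and the topology is the coarsest one that makes all of them continuous. -/
@[reducible]
noncomputable def weakStarTopology (H : Type*) [NormedAddCommGroup H] [InnerProductSpace ℂ H] :
    TopologicalSpace (H →L[ℂ] H) :=
  TopologicalSpace.induced
    (fun T (p : lp (fun _ : ℕ => H) 2 × lp (fun _ : ℕ => H) 2) =>
      ∑' n, inner ℂ (p.2 n) (T (p.1 n)))
    Pi.topologicalSpace

/-- The closure of a set of bounded operators in the weak* topology. -/
def weakStarClosure {H : Type*} [NormedAddCommGroup H] [InnerProductSpace ℂ H]
    (S : Set (H →L[ℂ] H)) : Set (H →L[ℂ] H) :=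
  @closure (H →L[ℂ] H) (weakStarTopology H) S

/-!
The four conditions are proved in a cycle.

If `a` and `b` have equal spectral radii of commutators, then they have equal norms of commutators
with selfadjoint elements, since such commutators are skew-adjoint.

Suppose the norms agree. Taking `x = a` shows that `a` and `b` commute, so `n = a + ib` is normal and
`a`, `b` are the coordinate functions on its spectrum. A primitive ideal `P` cuts out a hull `K` in
that spectrum (`exists_hull`). For `p ≠ q` in `K`, take `f`, `g` supported near `p` and `q`. As `P` is
prime, `w = f(n) y g(n)` is nonzero for some `y`. Now `[a, w]` is nearly `(Re p - Re q) w`, and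
`[b, w]` nearly `(Im p - Im q) w`, while `w * w = 0`. Testing the hypothesis on `x = w + w⋆` gives
`|Re p - Re q| = |Im p - Im q|` (`abs_re_sub_eq_abs_im_sub`). A set with this property lies on a line
of slope `1` or `-1` (`exists_line`), which says that `a - b` or `a + b` is a scalar modulo `P`.

If this holds for all primitive `P`, the ideals generated by the commutators of `a + b` and of `a - b`
are orthogonal, by semisimplicity (`lie_mul_mul_lie_eq_zero`). Let `I` be the annihilator of the
second one, a closed ideal containing the first, and let `p` be the projection onto the closed
span of `I H`. It is the strong limit of an approximate unit of `I`, hence lies in the weak* closure,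
and it is central (`exists_support_projection`). Then `c = 2p - 1` and `z = b - ca` are central
(`exists_symmetry`).

Finally, if `b = ca + z`, then `[b, x] ^ n = c ^ n [a, x] ^ n` has the norm of `[a, x] ^ n`, and the
spectral radii agree by Gelfand's formula (`spectralRadius_lie_eq`).
-/

open Filter Topology
open scoped CStarAlgebra

/-! ### Primitive ideals -/

lemma IsPrimitiveIdeal.isClosed {B : Type*} [NormedRing B] [HasSummableGeomSeries B] {P : Ideal B}
    (hP : IsPrimitiveIdeal P) : IsClosed (P : Set B) := by
  obtain ⟨M, _, _, hM, rfl⟩ := hP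
  have h : ((Module.annihilator B M : Ideal B) : Set B) =
      ⋂ m : M, (LinearMap.ker (LinearMap.toSpanSingleton B M m) : Set B) := by
    ext r
    simp [Module.mem_annihilator]
  rw [h]
  refine isClosed_iInter fun m => ?_
  rcases eq_or_ne m 0 with rfl | hm
  · simp
  · have := IsSimpleModule.ker_toSpanSingleton_isMaximal B hm
    exact Ideal.IsMaximal.isClosed

/-- Primitive ideals are prime: the nonzero submodule spanned by `g • m` is the whole module. -/
lemma IsPrimitiveIdeal.exists_mul_mul_notMem {B : Type*} [Ring B] {P : Ideal B}
    (hP : IsPrimitiveIdeal P) {f g : B} (hf : f ∉ P) (hg : g ∉ P) : ∃ y, f * y * g ∉ P := by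
  obtain ⟨M, _, _, hM, rfl⟩ := hP
  simp only [Module.mem_annihilator, not_forall] at hf hg ⊢
  obtain ⟨m, hm⟩ := hf
  obtain ⟨m', hm'⟩ := hg
  obtain ⟨y, hy⟩ := IsSimpleModule.toSpanSingleton_surjective B hm' m
  refine ⟨y, m', ?_⟩
  simpa [mul_smul] using! (by simpa using hy : y • g • m' = m) ▸ hm

lemma IsPrimitiveIdeal.mul_mem_right {B : Type*} [Ring B] {P : Ideal B}
    (hP : IsPrimitiveIdeal P) {x : B} (y : B) (hx : x ∈ P) : x * y ∈ P := by
  obtain ⟨M, _, _, hM, rfl⟩ := hP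
  rw [Module.mem_annihilator] at hx ⊢
  intro m
  rw [mul_smul, hx]

/-- C*-algebras are semisimple: if `r ≠ 0`, some `k ≠ 0` lies in the spectrum of `r⋆r`, and a maximal
left ideal `L` containing `k - r⋆r` gives a simple module `B ⧸ L` that `r` does not annihilate. -/
lemma eq_zero_of_forall_mem_primitive {B : Type*} [CStarAlgebra B] {r : B}
    (h : ∀ P : Ideal B, IsPrimitiveIdeal P → r ∈ P) : r = 0 := by
  by_contra hr
  have : Nontrivial B := ⟨r, 0, hr⟩
  have hs : IsSelfAdjoint (star r * r) := .star_mul_self r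
  obtain ⟨k, hk, hk'⟩ := spectrum.exists_nnnorm_eq_spectralRadius (star r * r)
  have hk0 : k ≠ 0 := by
    rintro rfl
    rw [hs.spectralRadius_eq_nnnorm] at hk'
    simp only [nnnorm_zero, ENNReal.coe_zero] at hk'
    exact hr (by simpa using hk'.symm)
  have hsa : star (algebraMap ℂ B k - star r * r) = algebraMap ℂ B k - star r * r := by
    have hkr : star k = k := hs.mem_spectrum_eq_re hk ▸ Complex.conj_ofReal _
    rw [star_sub, hs.star_eq, ← algebraMap_star_comm, hkr]
  have hne : Ideal.span {algebraMap ℂ B k - star r * r} ≠ ⊤ := by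
    intro htop
    obtain ⟨c, hc⟩ := Ideal.mem_span_singleton'.1 ((Ideal.eq_top_iff_one _).1 htop)
    have hc' : (algebraMap ℂ B k - star r * r) * star c = 1 := by
      rw [← hsa, ← star_mul, hc, star_one]
    exact hk (isUnit_iff_exists.2 ⟨c, by rwa [left_inv_eq_right_inv hc hc'], hc⟩)
  obtain ⟨L, hL, hle⟩ := Ideal.exists_le_maximal _ hne
  have h2 : r ∈ Module.annihilator B (B ⧸ L) :=
    h _ ⟨B ⧸ L, inferInstance, inferInstance,
      isSimpleModule_iff_isCoatom.2 (Ideal.isMaximal_def.1 hL), rfl⟩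
  have h3 : star r * r ∈ L := by
    refine L.mul_mem_left _ ?_
    have := Module.mem_annihilator.1 h2 (Submodule.Quotient.mk 1)
    rwa [← Submodule.Quotient.mk_smul, smul_eq_mul, mul_one, Submodule.Quotient.mk_eq_zero] at this
  have h4 : algebraMap ℂ B k ∈ L := by
    simpa using L.add_mem (hle (Ideal.mem_span_singleton_self _)) h3
  exact hL.ne_top (L.eq_top_of_isUnit_mem h4 ((isUnit_iff_ne_zero.2 hk0).map _))

/-! ### The hull of an ideal in the joint spectrum -/

/-- The intersection of a closed left ideal with the commutative C*-algebra generated by a normal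
element consists of the functions vanishing on a set of complex numbers. -/
lemma exists_hull {B : Type*} [CStarAlgebra B] (n : B) [hn : IsStarNormal n] (P : Ideal B)
    (hP : IsClosed (P : Set B)) :
    ∃ K : Set ℂ, ∀ f : ℂ → ℂ, Continuous f → (cfc f n ∈ P ↔ ∀ z ∈ K, f z = 0) := by
  let φ : C(spectrum ℂ n, ℂ) →+* B := (cfcHom (R := ℂ) hn : C(spectrum ℂ n, ℂ) →⋆ₐ[ℂ] B)
  have hI : IsClosed (P.comap φ : Set C(spectrum ℂ n, ℂ)) :=
    hP.preimage (cfcHom_continuous (R := ℂ) hn)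
  refine ⟨Subtype.val '' (ContinuousMap.setOfIdeal (P.comap φ))ᶜ, fun f hf => ?_⟩
  rw [cfc_apply f n hn hf.continuousOn]
  have h : cfcHom hn ⟨_, hf.continuousOn.domRestrict⟩ ∈ P ↔
      (⟨_, hf.continuousOn.domRestrict⟩ : C(spectrum ℂ n, ℂ)) ∈ P.comap φ := Iff.rfl
  rw [h, ← ContinuousMap.idealOfSet_ofIdeal_isClosed hI, ContinuousMap.mem_idealOfSet,
    ContinuousMap.idealOfSet_ofIdeal_isClosed hI]
  simp only [Set.forall_mem_image, ContinuousMap.coe_mk, Set.domRestrict_apply]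

/-! ### Commutators with localized elements -/

/-- Localizing a normal element near `p` makes `φ n` almost act as the scalar `φ p`. -/
lemma norm_cfc_sub_mul_le {B : Type*} [CStarAlgebra B] (n : B) [IsStarNormal n] {f φ : ℂ → ℂ}
    (hf : Continuous f) (hφ : Continuous φ) (p : ℂ) {δ : ℝ} (hδ : 0 < δ)
    (h : ∀ z, f z ≠ 0 → ‖φ z - φ p‖ ≤ δ) (y : B) :
    ‖(cfc φ n - algebraMap ℂ B (φ p)) * (cfc f n * y)‖ ≤ δ * ‖cfc f n * y‖ ∧
    ‖(y * cfc f n) * (cfc φ n - algebraMap ℂ B (φ p))‖ ≤ δ * ‖y * cfc f n‖ := by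
  -- `ψ` is `φ - φ p` truncated to norm at most `δ`, which agrees with it on the support of `f`.
  let ψ : ℂ → ℂ := fun z => ((δ / max δ ‖φ z - φ p‖ : ℝ) : ℂ) * (φ z - φ p)
  have hm : ∀ z, 0 < max δ ‖φ z - φ p‖ := fun z => lt_max_of_lt_left hδ
  have hψ : Continuous ψ := by
    refine (Complex.continuous_ofReal.comp ?_).mul (by fun_prop)
    exact continuous_const.div (by fun_prop) fun z => (hm z).ne'
  have hψn : ‖cfc ψ n‖ ≤ δ := by
    refine norm_cfc_le hδ.le fun z _ => ?_
    rw [norm_mul, Complex.norm_real, Real.norm_of_nonneg (div_pos hδ (hm z)).le, div_mul_eq_mul_div,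
      div_le_iff₀ (hm z)]
    exact mul_le_mul_of_nonneg_left (le_max_right _ _) hδ.le
  have hsub : cfc φ n - algebraMap ℂ B (φ p) = cfc (fun z => φ z - φ p) n := by
    rw [cfc_sub _ _ n (by fun_prop) (by fun_prop), cfc_const _ n]
  have heq : ∀ z, (φ z - φ p) * f z = ψ z * f z := by
    intro z
    by_cases hz : f z = 0
    · simp [hz]
    · simp [ψ, max_eq_left (h z hz), hδ.ne']
  have h1 : (cfc φ n - algebraMap ℂ B (φ p)) * cfc f n = cfc ψ n * cfc f n := by
    rw [hsub, ← cfc_mul _ _ n (by fun_prop) (by fun_prop), ← cfc_mul _ _ n (by fun_prop) (by fun_prop)]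
    exact cfc_congr fun z _ => heq z
  have h2 : cfc f n * (cfc φ n - algebraMap ℂ B (φ p)) = cfc f n * cfc ψ n := by
    rw [hsub, (cfc_commute_cfc _ _ n).eq, ← hsub, h1, (cfc_commute_cfc _ _ n).eq]
  constructor
  · rw [← mul_assoc, h1, mul_assoc]
    exact (norm_mul_le _ _).trans (mul_le_mul_of_nonneg_right hψn (norm_nonneg _))
  · rw [mul_assoc, h2, ← mul_assoc, mul_comm δ]
    exact (norm_mul_le _ _).trans (mul_le_mul_of_nonneg_left hψn (norm_nonneg _))

lemma norm_lie_sub_smul_le {B : Type*} [CStarAlgebra B] {a w : B} {r s ε : ℝ}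
    (h1 : ‖(a - algebraMap ℂ B r) * w‖ ≤ ε * ‖w‖) (h2 : ‖w * (a - algebraMap ℂ B s)‖ ≤ ε * ‖w‖) :
    ‖⁅a, w⁆ - (((r - s : ℝ) : ℂ)) • w‖ ≤ 2 * ε * ‖w‖ := by
  have : ⁅a, w⁆ - (((r - s : ℝ) : ℂ)) • w =
      (a - algebraMap ℂ B r) * w - w * (a - algebraMap ℂ B s) := by
    rw [Ring.lie_def, sub_mul, mul_sub, ← Algebra.smul_def, ← Algebra.commutes, ← Algebra.smul_def]
    push_cast
    rw [sub_smul]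
    abel
  rw [this]
  linarith [norm_sub_le ((a - algebraMap ℂ B r) * w) (w * (a - algebraMap ℂ B s))]

/-- The commutator with the selfadjoint element `w + w⋆`, when `[a, w]` is almost `r w`. -/
lemma norm_lie_add_star_sub_smul_le {B : Type*} [CStarAlgebra B] {a w : B}
    (ha : IsSelfAdjoint a) {r ε : ℝ} (h : ‖⁅a, w⁆ - (r : ℂ) • w‖ ≤ ε) :
    ‖⁅a, w + star w⁆ - (r : ℂ) • (w - star w)‖ ≤ 2 * ε := by
  have : ⁅a, w + star w⁆ - (r : ℂ) • (w - star w) =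
      (⁅a, w⁆ - (r : ℂ) • w) - star (⁅a, w⁆ - (r : ℂ) • w) := by
    simp only [Ring.lie_def, star_sub, star_mul, ha.star_eq, star_smul, Complex.star_def,
      Complex.conj_ofReal, smul_sub]
    noncomm_ring
  rw [this]
  refine (norm_sub_le _ _).trans ?_
  rw [norm_star]
  linarith

lemma norm_le_norm_sub_star {B : Type*} [CStarAlgebra B] {w : B} (hw : w * w = 0) :
    ‖w‖ ≤ ‖w - star w‖ := by
  rcases eq_or_ne w 0 with rfl | h0
  · simp
  have h : (w - star w) * star w = w * star w := by
    have : star w * star w = 0 := by rw [← star_mul, hw, star_zero]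
    rw [sub_mul, this, sub_zero]
  have h1 : ‖w‖ * ‖w‖ ≤ ‖w - star w‖ * ‖w‖ := by
    rw [← CStarRing.norm_self_mul_star, ← h, ← norm_star w]
    exact norm_mul_le _ _
  exact le_of_mul_le_mul_right h1 (norm_pos_iff.2 h0)

/-- If `[a, w]` is almost `r w` and `[b, w]` almost `s w`, comparing the norms of the commutators with
`w + w⋆` gives `|r| ≈ |s|`; `w * w = 0` keeps `w - w⋆` from being small. -/
lemma abs_abs_sub_abs_le_of_norm_lie_eq {B : Type*} [CStarAlgebra B] {a b w : B} (ha : IsSelfAdjoint a)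
    (hb : IsSelfAdjoint b) (hab : ∀ x : B, IsSelfAdjoint x → ‖⁅a, x⁆‖ = ‖⁅b, x⁆‖)
    (hw : w * w = 0) (hw0 : w ≠ 0) {r s ε : ℝ}
    (h1 : ‖⁅a, w⁆ - (r : ℂ) • w‖ ≤ ε * ‖w‖) (h2 : ‖⁅b, w⁆ - (s : ℂ) • w‖ ≤ ε * ‖w‖) :
    |(|r| - |s|)| ≤ 4 * ε := by
  have hN := norm_le_norm_sub_star hw
  have hp : 0 < ‖w‖ := norm_pos_iff.2 hw0
  have key : ∀ (c : B) (t : ℝ), IsSelfAdjoint c → ‖⁅c, w⁆ - (t : ℂ) • w‖ ≤ ε * ‖w‖ →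
      |‖⁅c, w + star w⁆‖ - |t| * ‖w - star w‖| ≤ 2 * (ε * ‖w‖) := by
    intro c t hc h
    refine le_trans ?_ (norm_lie_add_star_sub_smul_le hc h)
    have := abs_norm_sub_norm_le ⁅c, w + star w⁆ ((t : ℂ) • (w - star w))
    rwa [norm_smul, Complex.norm_real, Real.norm_eq_abs] at this
  have ka := key a r ha h1
  have kb := key b s hb h2
  rw [← hab _ (IsSelfAdjoint.add_star_self w)] at kb
  have h3 : |(|r| - |s|)| * ‖w - star w‖ ≤ 4 * ε * ‖w‖ := by
    have : |(|r| - |s|)| * ‖w - star w‖ = |(|r| * ‖w - star w‖ - |s| * ‖w - star w‖)| := by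
      rw [← sub_mul, abs_mul, abs_of_nonneg (norm_nonneg (w - star w))]
    rw [this]
    rw [abs_le] at ka kb ⊢
    constructor <;> linarith
  refine le_of_mul_le_mul_right (le_trans ?_ h3) hp
  exact mul_le_mul_of_nonneg_left hN (abs_nonneg _)

lemma exists_bump (p : ℂ) {δ : ℝ} (hδ : 0 < δ) :
    ∃ f : ℂ → ℂ, Continuous f ∧ f p ≠ 0 ∧ ∀ z, f z ≠ 0 → dist z p < δ := by
  refine ⟨fun z => ((max 0 (δ - dist z p) : ℝ) : ℂ), by fun_prop, ?_, fun z hz => ?_⟩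
  · simp [hδ.le, hδ.ne']
  · by_contra! h
    exact hz (by simp [h])

/-- Two points of the hull of a primitive ideal in the joint spectrum of `a` and `b` have
coordinates differing by the same amount, up to sign. -/
lemma abs_re_sub_eq_abs_im_sub {B : Type*} [CStarAlgebra B] {a b n : B} [IsStarNormal n]
    (ha : a = cfc (fun z => (z.re : ℂ)) n) (hb : b = cfc (fun z => (z.im : ℂ)) n)
    (hsa : IsSelfAdjoint a) (hsb : IsSelfAdjoint b)
    (hab : ∀ x : B, IsSelfAdjoint x → ‖⁅a, x⁆‖ = ‖⁅b, x⁆‖) {P : Ideal B}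
    (hP : IsPrimitiveIdeal P) {K : Set ℂ}
    (hK : ∀ f : ℂ → ℂ, Continuous f → (cfc f n ∈ P ↔ ∀ z ∈ K, f z = 0)) {p q : ℂ}
    (hp : p ∈ K) (hq : q ∈ K) : |p.re - q.re| = |p.im - q.im| := by
  rcases eq_or_ne p q with rfl | hpq
  · simp
  rw [← sub_eq_zero, ← abs_eq_zero]
  refine le_antisymm (le_of_forall_pos_le_add fun ε hε => ?_) (abs_nonneg _)
  obtain ⟨δ, hδ, hδε, hδd⟩ : ∃ δ > 0, 8 * δ ≤ ε ∧ 2 * δ ≤ dist p q := by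
    have := dist_pos.2 hpq
    refine ⟨min (ε / 8) (dist p q / 2), by positivity, ?_, ?_⟩
    · linarith [min_le_left (ε / 8) (dist p q / 2)]
    · linarith [min_le_right (ε / 8) (dist p q / 2)]
  obtain ⟨f, hf, hfp, hfs⟩ := exists_bump p hδ
  obtain ⟨g, hg, hgq, hgs⟩ := exists_bump q hδ
  have hfP : cfc f n ∉ P := fun h => hfp ((hK f hf).1 h p hp)
  have hgP : cfc g n ∉ P := fun h => hgq ((hK g hg).1 h q hq)
  obtain ⟨y, hy⟩ := hP.exists_mul_mul_notMem hfP hgP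
  have hgf : cfc g n * cfc f n = 0 := by
    rw [← cfc_mul _ _ n (by fun_prop) (by fun_prop)]
    refine (cfc_congr (g := fun _ => (0 : ℂ)) fun z _ => ?_).trans (cfc_const_zero ℂ n)
    by_contra h
    have h1 := hfs z (right_ne_zero_of_mul h)
    have h2 := hgs z (left_ne_zero_of_mul h)
    linarith [dist_triangle_left p q z]
  have hw0 : cfc f n * y * cfc g n ≠ 0 := fun h => hy (h ▸ P.zero_mem)
  have hw : cfc f n * y * cfc g n * (cfc f n * y * cfc g n) = 0 := by
    have : cfc f n * y * cfc g n * (cfc f n * y * cfc g n) =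
      cfc f n * y * (cfc g n * cfc f n) * (y * cfc g n) := by noncomm_ring
    rw [this, hgf, mul_zero, zero_mul]
  have key : ∀ φ : ℂ → ℝ, Continuous φ → (∀ z w, |φ z - φ w| ≤ dist z w) →
      ‖⁅cfc (fun z => (φ z : ℂ)) n, cfc f n * y * cfc g n⁆ -
        ((φ p - φ q : ℝ) : ℂ) • (cfc f n * y * cfc g n)‖ ≤ 2 * δ * ‖cfc f n * y * cfc g n‖ := by
    intro φ hφ hl
    have hl' : ∀ z w, ‖(φ z : ℂ) - φ w‖ ≤ dist z w := fun z w => by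
      rw [← Complex.ofReal_sub, Complex.norm_real]
      exact hl z w
    apply norm_lie_sub_smul_le
    · have := (norm_cfc_sub_mul_le n hf (φ := fun z => (φ z : ℂ)) (by fun_prop) p hδ
        (fun z hz => (hl' z p).trans (hfs z hz).le) (y * cfc g n)).1
      rwa [← mul_assoc (cfc f n)] at this
    · exact (norm_cfc_sub_mul_le n hg (φ := fun z => (φ z : ℂ)) (by fun_prop) q hδ
        (fun z hz => (hl' z q).trans (hgs z hz).le) (cfc f n * y)).2
  have h := abs_abs_sub_abs_le_of_norm_lie_eq hsa hsb hab hw hw0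
    (ha ▸ key Complex.re Complex.continuous_re fun z w => by
      rw [← Complex.sub_re, dist_eq_norm]; exact Complex.abs_re_le_norm _)
    (hb ▸ key Complex.im Complex.continuous_im fun z w => by
      rw [← Complex.sub_im, dist_eq_norm]; exact Complex.abs_im_le_norm _)
  linarith

/-- A plane set in which any two points lie on a common line of slope `1` or `-1` lies on one such
line. -/
lemma exists_line {K : Set ℂ} (h : ∀ p ∈ K, ∀ q ∈ K, |p.re - q.re| = |p.im - q.im|) :
    (∃ c : ℝ, ∀ z ∈ K, z.re + z.im = c) ∨ (∃ c : ℝ, ∀ z ∈ K, z.re - z.im = c) := by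
  by_contra! hc
  obtain ⟨h1, h2⟩ := hc
  obtain ⟨p, hp, -⟩ := h1 0
  obtain ⟨q, hq, hq'⟩ := h1 (p.re + p.im)
  obtain ⟨r, hr, hr'⟩ := h2 (p.re - p.im)
  have hpq := abs_eq_abs.1 (h q hq p hp)
  have hpr := abs_eq_abs.1 (h r hr p hp)
  have hqr := abs_eq_abs.1 (h q hq r hr)
  -- `q` and `p` differ in `re + im` only, `r` and `p` in `re - im` only, so `q` and `r` in both.
  rcases hpq with hpq | hpq
  · rcases hpr with hpr | hpr
    · exact hr' (by linarith)
    · rcases hqr with hqr | hqr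
      · exact hr' (by linarith)
      · exact hq' (by linarith)
  · exact hq' (by linarith)

/-- The hull of a primitive ideal in the joint spectrum of `a` and `b` lies on a line of slope `-1` or
`1`, so `a + b` or `a - b` is constant on it. -/
lemma scalar_mod_primitive {B : Type*} [CStarAlgebra B] {a b : B} (hsa : IsSelfAdjoint a)
    (hsb : IsSelfAdjoint b) (hab : ∀ x : B, IsSelfAdjoint x → ‖⁅a, x⁆‖ = ‖⁅b, x⁆‖) {P : Ideal B}
    (hP : IsPrimitiveIdeal P) :
    (∃ μ : ℂ, a + b - algebraMap ℂ B μ ∈ P) ∨ (∃ μ : ℂ, a - b - algebraMap ℂ B μ ∈ P) := by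
  have hc : a * b = b * a := by
    have := hab a hsa
    rw [Ring.lie_def a a, sub_self, norm_zero] at this
    exact (sub_eq_zero.1 (norm_eq_zero.1 this.symm)).symm
  let n : B := a + Complex.I • b
  have hstar : star n = a - Complex.I • b := by
    simp [n, hsa.star_eq, hsb.star_eq, sub_eq_add_neg]
  have hn : IsStarNormal n := ⟨by
    rw [hstar]
    simp only [n, Commute, SemiconjBy, add_mul, mul_add, sub_mul, mul_sub, smul_mul_assoc,
      mul_smul_comm, smul_add, smul_sub, hc]
    abel⟩
  have hid : cfc (fun z : ℂ => z) n = n := cfc_id' ℂ n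
  have hst : cfc (fun z : ℂ => star z) n = star n := cfc_star_id n
  have hre : a = cfc (fun z => (z.re : ℂ)) n := by
    have : (fun z : ℂ => (z.re : ℂ)) = fun z => (1 / 2 : ℂ) • (z + star z) := by
      ext z
      rw [Complex.re_eq_add_conj, smul_eq_mul, Complex.star_def]
      ring
    rw [this, cfc_smul _ _ _ (by fun_prop), cfc_add .., hid, hst, hstar]
    simp only [n]
    module
  have him : b = cfc (fun z => (z.im : ℂ)) n := by
    have : (fun z : ℂ => (z.im : ℂ)) = fun z => (-Complex.I / 2 : ℂ) • (z - star z) := by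
      ext z
      rw [Complex.im_eq_sub_conj, smul_eq_mul, Complex.star_def]
      field_simp
      simp
    rw [this, cfc_smul _ _ _ (by fun_prop), cfc_sub .., hid, hst, hstar]
    have : a + Complex.I • b - (a - Complex.I • b) = (2 * Complex.I) • b := by module
    simp only [n]
    rw [this, smul_smul]
    have : -Complex.I / 2 * (2 * Complex.I) = 1 := by
      ring_nf
      simp
    rw [this, one_smul]
  obtain ⟨K, hK⟩ := exists_hull n P hP.isClosed
  rcases exists_line fun p hp q hq =>
    abs_re_sub_eq_abs_im_sub hre him hsa hsb hab hP hK hp hq with ⟨c, h⟩ | ⟨c, h⟩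
  · refine .inl ⟨c, ?_⟩
    have := (hK (fun z => (z.re : ℂ) + z.im - c) (by fun_prop)).2 fun z hz => by
      rw [← h z hz]
      push_cast
      ring
    rwa [cfc_sub _ _ n (by fun_prop) (by fun_prop), cfc_add _ _ _ (by fun_prop) (by fun_prop),
      cfc_const _ n, ← hre, ← him] at this
  · refine .inr ⟨c, ?_⟩
    have := (hK (fun z => (z.re : ℂ) - z.im - c) (by fun_prop)).2 fun z hz => by
      rw [← h z hz]
      push_cast
      ring
    rwa [cfc_sub _ _ n (by fun_prop) (by fun_prop), cfc_sub _ _ _ (by fun_prop) (by fun_prop),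
      cfc_const _ n, ← hre, ← him] at this

/-- If modulo every primitive ideal `u` or `v` is a scalar, the ideals generated by the commutators of
`u` and of `v` are orthogonal, because their product lies in every primitive ideal. -/
lemma lie_mul_mul_lie_eq_zero {B : Type*} [CStarAlgebra B] {u v : B}
    (h : ∀ P : Ideal B, IsPrimitiveIdeal P →
      (∃ μ : ℂ, u - algebraMap ℂ B μ ∈ P) ∨ (∃ μ : ℂ, v - algebraMap ℂ B μ ∈ P)) (x y w : B) :
    ⁅u, x⁆ * y * ⁅v, w⁆ = 0 := by
  refine eq_zero_of_forall_mem_primitive fun P hP => ?_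
  have key : ∀ (t s : B) (μ : ℂ), t - algebraMap ℂ B μ ∈ P → ⁅t, s⁆ ∈ P := by
    intro t s μ ht
    have : ⁅t, s⁆ = (t - algebraMap ℂ B μ) * s - s * (t - algebraMap ℂ B μ) := by
      rw [Ring.lie_def, sub_mul, mul_sub, Algebra.commutes]
      abel
    rw [this]
    exact P.sub_mem (hP.mul_mem_right _ ht) (P.mul_mem_left _ ht)
  rcases h P hP with ⟨μ, hμ⟩ | ⟨μ, hμ⟩
  · exact hP.mul_mem_right _ (hP.mul_mem_right _ (key u x μ hμ))
  · exact P.mul_mem_left _ (key v w μ hμ)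

/-! ### The weak* closure -/

section Hilbert

variable {H : Type*} [NormedAddCommGroup H] [InnerProductSpace ℂ H]

/-- The limit of a bounded strongly convergent net is a weak* limit, by dominated convergence. -/
lemma mem_weakStarClosure_of_tendsto {ι : Type*} {l : Filter ι} [l.NeBot] {S : Set (H →L[ℂ] H)}
    {T : ι → H →L[ℂ] H} {T₀ : H →L[ℂ] H} (hS : ∀ i, T i ∈ S) {C : ℝ} (hC : ∀ᶠ i in l, ‖T i‖ ≤ C)
    (hT : ∀ ξ, Tendsto (fun i => T i ξ) l (𝓝 (T₀ ξ))) : T₀ ∈ weakStarClosure S := by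
  let _ : TopologicalSpace (H →L[ℂ] H) := weakStarTopology H
  refine mem_closure_of_tendsto (b := l) (f := T) ?_ (.of_forall hS)
  rw [nhds_induced, tendsto_comap_iff, tendsto_pi_nhds]
  rintro ⟨ξ, η⟩
  refine tendsto_tsum_of_dominated_convergence (bound := fun k => ‖η k‖ * (C * ‖ξ k‖)) ?_
    (fun k => tendsto_const_nhds.inner (hT (ξ k))) ?_
  · have h := Real.summable_mul_of_Lp_Lq_of_nonneg (p := 2) (q := 2)
      (by constructor <;> norm_num) (fun k => norm_nonneg (η k)) (fun k => norm_nonneg (ξ k))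
      (by simpa using (lp.memℓp η).summable (by norm_num))
      (by simpa using (lp.memℓp ξ).summable (by norm_num))
    simpa [mul_left_comm] using h.mul_left C
  · filter_upwards [hC] with i hi k
    refine (norm_inner_le_norm _ _).trans (mul_le_mul_of_nonneg_left ?_ (norm_nonneg _))
    exact (T i).le_of_opNorm_le hi _

/-- Multiplication is separately weak* continuous, so an operator commuting with a set commutes with
its weak* closure. -/
lemma mem_centralizer_weakStarClosure [CompleteSpace H] {S : Set (H →L[ℂ] H)} {c : H →L[ℂ] H}
    (hc : c ∈ Set.centralizer S) : c ∈ Set.centralizer (weakStarClosure S) := by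
  let _ : TopologicalSpace (H →L[ℂ] H) := weakStarTopology H
  have hcont : ∀ ξ η : H, Continuous fun T : H →L[ℂ] H => inner ℂ η (T ξ) := by
    intro ξ η
    have h : Continuous fun (T : H →L[ℂ] H)
        (p : lp (fun _ : ℕ => H) 2 × lp (fun _ : ℕ => H) 2) =>
          ∑' n, inner ℂ (p.2 n) (T (p.1 n)) := continuous_induced_dom
    have h2 := (continuous_apply (lp.single 2 (0 : ℕ) ξ, lp.single 2 (0 : ℕ) η)).comp h
    refine h2.congr fun T => ?_
    refine (tsum_eq_single 0 fun k hk => ?_).trans ?_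
    · simp [lp.single_apply, Pi.single_eq_of_ne hk]
    · simp [lp.single_apply]
  have hclosed : IsClosed {T : H →L[ℂ] H | ∀ ξ η : H, inner ℂ η (T (c ξ)) =
      inner ℂ (ContinuousLinearMap.adjoint c η) (T ξ)} := by
    simp only [Set.ofPred_forall]
    exact isClosed_iInter fun ξ => isClosed_iInter fun η =>
      isClosed_eq (hcont _ _) (hcont _ _)
  intro T hT
  have := closure_minimal (t := _) (fun T hT ξ η => ?_) hclosed hT
  · ext ξ
    refine ext_inner_left ℂ fun η => ?_
    simpa [ContinuousLinearMap.adjoint_inner_left] using this ξ η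
  · have := congr($(hc T hT) ξ)
    simp only [mul_apply_eq_comp] at this
    rw [this, ContinuousLinearMap.adjoint_inner_left]

end Hilbert

/-! ### The support projection of a closed ideal -/

section Support

variable {B : Type*} [CStarAlgebra B] {H : Type*} [NormedAddCommGroup H] [InnerProductSpace ℂ H]
  [CompleteSpace H]

/-- A closed two-sided selfadjoint ideal `I` acts on a subspace whose orthogonal projection `p` is
the strong limit of an approximate unit of `I`. It commutes with the algebra and is a unit for
`I`; also `π j * p = 0` as soon as `j` annihilates `I`. -/
lemma exists_support_projection (π : B →⋆ₙₐ[ℂ] (H →L[ℂ] H)) (I : NonUnitalStarSubalgebra ℂ B)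
    (hI : IsClosed (I : Set B)) (hmul : ∀ x : B, ∀ r ∈ I, x * r ∈ I) :
    ∃ (p : H →L[ℂ] H) (l : Filter I), l.NeBot ∧ (∀ᶠ e : I in l, ‖(e : B)‖ ≤ 1) ∧
      (∀ ξ, Tendsto (fun e : I => π e ξ) l (𝓝 (p ξ))) ∧ IsSelfAdjoint p ∧ p * p = p ∧
      (∀ x, Commute p (π x)) ∧ (∀ r ∈ I, p * π r = π r) ∧
      (∀ j, (∀ r ∈ I, j * r = 0) → π j * p = 0) := by
  let V : Submodule ℂ H := (Submodule.span ℂ {ζ | ∃ r ∈ I, ∃ η, π r η = ζ}).topologicalClosure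
  have : CompleteSpace V := (Submodule.isClosed_topologicalClosure _).completeSpace_coe
  -- To lie in `V` is to be mapped into a closed subspace by whatever maps the generators there.
  have hV : ∀ (T : H →L[ℂ] H) (W : Submodule ℂ H), IsClosed (W : Set H) →
      (∀ r ∈ I, ∀ η, T (π r η) ∈ W) → ∀ ξ ∈ V, T ξ ∈ W := by
    intro T W hW h
    have : V ≤ W.comap (T : H →ₗ[ℂ] H) := by
      refine Submodule.topologicalClosure_minimal _ ?_ (hW.preimage T.continuous)
      rw [Submodule.span_le]
      rintro _ ⟨r, hr, η, rfl⟩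
      exact h r hr η
    exact this
  have hVr : ∀ r ∈ I, ∀ η, π r η ∈ V := fun r hr η =>
    Submodule.le_topologicalClosure _ (Submodule.subset_span ⟨r, hr, η, rfl⟩)
  let p : H →L[ℂ] H := V.starProjection
  have hpV : ∀ ξ, p ξ ∈ V := fun ξ => V.starProjection_apply_mem ξ
  have hp1 : ∀ ξ ∈ V, p ξ = ξ := fun ξ hξ => Submodule.starProjection_eq_self_iff.2 hξ
  have hpsa : IsSelfAdjoint p := isSelfAdjoint_starProjection V
  have hcomm : ∀ x, Commute p (π x) := by
    have h : ∀ x, p * π x * p = π x * p := by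
      intro x
      ext ξ
      refine hp1 _ (hV (π x) V (Submodule.isClosed_topologicalClosure _) ?_ _ (hpV ξ))
      intro r hr η
      rw [← mul_apply_eq_comp, ← map_mul]
      exact hVr _ (hmul x r hr) η
    intro x
    have h' := congr(star $(h (star x)))
    simp only [star_mul, hpsa.star_eq, map_star, star_star] at h'
    rw [← mul_assoc, h x] at h'
    exact h'.symm
  have hpr : ∀ r ∈ I, p * π r = π r := fun r hr => by
    ext η
    exact hp1 _ (hVr r hr η)
  let _ : PartialOrder I := CStarAlgebra.spectralOrder I
  have : StarOrderedRing I := CStarAlgebra.spectralOrderedRing I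
  have hl := CStarAlgebra.increasingApproximateUnit I
  have hπn : ∀ x, ‖π x‖ ≤ ‖x‖ := fun x => NonUnitalStarAlgHom.norm_apply_le π x
  refine ⟨p, CStarAlgebra.approximateUnit I, hl.neBot, hl.eventually_norm, ?_, hpsa, ?_, hcomm,
    hpr, ?_⟩
  · -- The approximate unit converges to the identity on `V`, and `e = e p` for `e` in the ideal.
    have hspan : ∀ ζ ∈ Submodule.span ℂ {ζ | ∃ r ∈ I, ∃ η, π r η = ζ},
        Tendsto (fun e : I => π e ζ) (CStarAlgebra.approximateUnit I) (𝓝 ζ) := by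
      intro ζ hζ
      induction hζ using Submodule.span_induction with
      | mem ζ h =>
        obtain ⟨r, hr, η, rfl⟩ := h
        have h1 : Tendsto (fun e : I => (e : B) * r) (CStarAlgebra.approximateUnit I) (𝓝 r) :=
          (continuous_subtype_val.tendsto _).comp (hl.tendsto_mul_right ⟨r, hr⟩)
        have h2 : Continuous fun x : B => π x η :=
          (ContinuousLinearMap.apply ℂ H η).continuous.comp (map_continuous π)
        refine ((h2.tendsto r).comp h1).congr fun e => ?_
        simp
      | zero => simp
      | add x y _ _ hx hy => simpa using hx.add hy
      | smul c x _ hx => simpa using hx.const_smul c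
    have hconv : ∀ ξ ∈ V, Tendsto (fun e : I => π e ξ) (CStarAlgebra.approximateUnit I) (𝓝 ξ) := by
      intro ξ hξ
      rw [Metric.tendsto_nhds]
      intro ε hε
      obtain ⟨ζ, hζ, hd⟩ := Metric.mem_closure_iff.1 hξ (ε / 3) (by positivity)
      filter_upwards [Metric.tendsto_nhds.1 (hspan ζ hζ) (ε / 3) (by positivity),
        hl.eventually_norm] with e he he1
      have h1 : dist (π e ξ) (π e ζ) ≤ dist ξ ζ := by
        rw [dist_eq_norm, dist_eq_norm, ← map_sub]
        simpa using (π (e : B)).le_of_opNorm_le ((hπn e).trans he1) (ξ - ζ)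
      have h2 := dist_triangle4 (π e ξ) (π e ζ) ζ ξ
      rw [dist_comm ζ ξ] at h2
      linarith
    intro ξ
    refine (hconv (p ξ) (hpV ξ)).congr fun e => ?_
    rw [← mul_apply_eq_comp, ← (hcomm e).eq, hpr e e.2]
  · ext ξ
    exact hp1 _ (hpV ξ)
  · intro j hj
    ext ξ
    refine (Submodule.mem_bot ℂ).1 (hV (π j) ⊥ isClosed_singleton ?_ _ (hpV ξ))
    intro r hr η
    rw [← mul_apply_eq_comp, ← map_mul, hj r hr, map_zero]
    simp

end Support

/-! ### The central symmetry -/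

section

variable {B : Type*} [CStarAlgebra B]

/-- The two-sided annihilator of the ideal generated by the commutators of `v`. -/
def commutatorAnnihilator (v : B) (hv : IsSelfAdjoint v) : NonUnitalStarSubalgebra ℂ B where
  carrier := {r | ∀ y w, r * y * ⁅v, w⁆ = 0 ∧ ⁅v, w⁆ * y * r = 0}
  add_mem' {r s} hr hs y w := by simp [add_mul, mul_add, hr y w, hs y w]
  zero_mem' y w := by simp
  mul_mem' {r s} hr hs y w :=
    ⟨by simpa [mul_assoc] using (hr (s * y) w).1, by simpa [mul_assoc] using (hs (y * r) w).2⟩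
  smul_mem' k r hr y w := by simp [hr y w]
  star_mem' {r} hr y w := by
    have h : ⁅v, w⁆ = -star ⁅v, star w⁆ := by simp [Ring.lie_def, hv.star_eq]
    have h1 := congr(star $((hr (star y) (star w)).1))
    have h2 := congr(star $((hr (star y) (star w)).2))
    simp only [star_mul, star_star, star_zero, ← mul_assoc] at h1 h2
    simp [h, h1, h2]

lemma isClosed_commutatorAnnihilator (v : B) (hv : IsSelfAdjoint v) :
    IsClosed (commutatorAnnihilator v hv : Set B) := by
  have : (commutatorAnnihilator v hv : Set B) =
      ⋂ (y : B) (w : B), {r | r * y * ⁅v, w⁆ = 0} ∩ {r | ⁅v, w⁆ * y * r = 0} := by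
    ext r
    simp only [Set.mem_iInter, Set.mem_inter_iff, Set.mem_ofPred_eq]
    exact Iff.rfl
  rw [this]
  exact isClosed_iInter fun y => isClosed_iInter fun w =>
    (isClosed_eq (by fun_prop) (by fun_prop)).inter (isClosed_eq (by fun_prop) (by fun_prop))

variable {H : Type*} [NormedAddCommGroup H] [InnerProductSpace ℂ H] [CompleteSpace H]

/-- If the commutators of `a + b` and of `a - b` generate orthogonal ideals, the symmetry is
`c = 2p - 1` with `p` a central projection that fixes the first ideal and kills the second. -/
lemma exists_symmetry (π : B →⋆ₙₐ[ℂ] (H →L[ℂ] H)) {a b : B} (ha : IsSelfAdjoint a)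
    (hb : IsSelfAdjoint b) (h1 : ∀ x y w : B, ⁅a + b, x⁆ * y * ⁅a - b, w⁆ = 0)
    (h2 : ∀ x y w : B, ⁅a - b, x⁆ * y * ⁅a + b, w⁆ = 0) :
    ∃ c z : H →L[ℂ] H,
      (c ∈ weakStarClosure (Set.range π) ∧
        c ∈ Set.centralizer (weakStarClosure (Set.range π))) ∧
      (z ∈ weakStarClosure (Set.range π) ∧
        z ∈ Set.centralizer (weakStarClosure (Set.range π))) ∧
      IsSelfAdjoint c ∧ IsSelfAdjoint z ∧ c ^ 2 = π 1 ∧ π b = c * π a + z := by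
  obtain ⟨p, l, hl, hle, hlp, hpsa, hpp, hpc, hpI, hpJ⟩ := exists_support_projection π
    (commutatorAnnihilator (a - b) (ha.sub hb)) (isClosed_commutatorAnnihilator _ _)
    fun x r hr y w => ⟨by rw [mul_assoc x, mul_assoc x, (hr y w).1, mul_zero],
      by rw [← mul_assoc, mul_assoc ⁅a - b, w⁆, (hr (y * x) w).2]⟩
  have hπn : ∀ x, ‖π x‖ ≤ ‖x‖ := fun x => NonUnitalStarAlgHom.norm_apply_le π x
  have hplus : ∀ x, p * π ⁅a + b, x⁆ = π ⁅a + b, x⁆ := fun x =>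
    hpI _ fun y w => ⟨h1 x y w, h2 w y x⟩
  have hminus : ∀ x, p * π ⁅a - b, x⁆ = 0 := fun x => by
    rw [(hpc _).eq]
    exact hpJ _ fun r hr => by simpa using (hr 1 x).2
  have h1p : p * π 1 = p := by
    -- In the limit, the approximate unit `e` satisfies `1 * e = e`.
    rw [(hpc 1).eq]
    ext ξ
    refine tendsto_nhds_unique (((π 1).continuous.tendsto _).comp (hlp ξ))
      ((hlp ξ).congr fun e => ?_)
    rw [Function.comp_apply, ← mul_apply_eq_comp, ← map_mul, one_mul]
  have hone : IsSelfAdjoint (π 1) := (IsSelfAdjoint.one B).map π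
  let c : H →L[ℂ] H := 2 • p - π 1
  have hcc : ∀ x, Commute c (π x) := fun x => by
    refine ((hpc x).smul_left 2).sub_left ?_
    rw [Commute, SemiconjBy, ← map_mul, ← map_mul, one_mul, mul_one]
  have hcsa : IsSelfAdjoint c := by
    refine IsSelfAdjoint.sub ?_ hone
    rw [two_smul]
    exact hpsa.add hpsa
  let z : H →L[ℂ] H := π b - c * π a
  have hzc : ∀ x, Commute z (π x) := by
    intro x
    have e1 := hplus x
    have e2 := hminus x
    simp only [Ring.lie_def, map_sub, map_mul, map_add, add_mul, mul_add, sub_mul, mul_sub]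
      at e1 e2
    have e3 := (hcc x).eq
    have e4 : π 1 * (π a * π x) = π a * π x := by simp only [← map_mul, one_mul]
    have e5 : π 1 * (π x * π a) = π x * π a := by simp only [← map_mul, one_mul]
    rw [Commute, SemiconjBy, sub_mul, mul_sub, ← mul_assoc (π x) c, ← e3]
    simp only [c, sub_mul, smul_mul_assoc, mul_assoc, e4, e5]
    linear_combination (norm := module) -e1 - e2
  have hzsa : IsSelfAdjoint z := by
    refine (hb.map π).sub ?_
    rw [IsSelfAdjoint, star_mul, hcsa.star_eq, (ha.map π).star_eq, (hcc a).eq]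
  have hclim : ∀ ξ, Tendsto (fun e : commutatorAnnihilator (a - b) (ha.sub hb) =>
      π (2 • (e : B) - 1) ξ) l (𝓝 (c ξ)) := by
    intro ξ
    simpa [c, two_smul] using ((hlp ξ).add (hlp ξ)).sub_const (π 1 ξ)
  have hzlim : ∀ ξ, Tendsto (fun e : commutatorAnnihilator (a - b) (ha.sub hb) =>
      π (b - (2 • (e : B) - 1) * a) ξ) l (𝓝 (z ξ)) := by
    intro ξ
    refine ((hclim (π a ξ)).const_sub (π b ξ)).congr fun e => ?_
    rw [map_sub π b, map_mul]
    rfl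
  have hbound : ∀ᶠ e : commutatorAnnihilator (a - b) (ha.sub hb) in l,
      ‖2 • (e : B) - 1‖ ≤ 2 + ‖(1 : B)‖ := by
    filter_upwards [hle] with e he
    refine (norm_sub_le _ _).trans (add_le_add_left ?_ _)
    rw [two_smul]
    linarith [norm_add_le (e : B) e]
  refine ⟨c, z, ⟨?_, ?_⟩, ⟨?_, ?_⟩, hcsa, hzsa, ?_, ?_⟩
  · refine mem_weakStarClosure_of_tendsto (fun e => Set.mem_range_self _) ?_ hclim
      (C := 2 + ‖(1 : B)‖)
    filter_upwards [hbound] with e he using (hπn _).trans he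
  · refine mem_centralizer_weakStarClosure ?_
    rintro _ ⟨x, rfl⟩
    exact (hcc x).eq.symm
  · refine mem_weakStarClosure_of_tendsto (fun e => Set.mem_range_self _) ?_ hzlim
      (C := ‖b‖ + (2 + ‖(1 : B)‖) * ‖a‖)
    filter_upwards [hbound] with e he
    refine (hπn _).trans ((norm_sub_le _ _).trans (add_le_add_right ?_ _))
    exact (norm_mul_le _ _).trans (mul_le_mul_of_nonneg_right he (norm_nonneg _))
  · refine mem_centralizer_weakStarClosure ?_
    rintro _ ⟨x, rfl⟩
    exact (hzc x).eq.symm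
  · have e1 : π 1 * p = p := by rw [← (hpc 1).eq, h1p]
    have e2 : π 1 * π 1 = π 1 := by rw [← map_mul, one_mul]
    simp only [c, pow_two, sub_mul, mul_sub, smul_mul_assoc, mul_smul_comm, hpp, h1p, e1, e2]
    module
  · exact (add_sub_cancel _ _).symm

end

/-- Multiplying commutators by a central symmetry does not change the norms of their powers. -/
lemma spectralRadius_lie_eq {B : Type*} [CStarAlgebra B] {H : Type*} [NormedAddCommGroup H]
    [InnerProductSpace ℂ H] [CompleteSpace H] (π : B →⋆ₙₐ[ℂ] (H →L[ℂ] H))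
    (hπ : Function.Injective π) {a b : B} {c z : H →L[ℂ] H} (hc : ∀ x, Commute c (π x))
    (hz : ∀ x, Commute z (π x)) (hcsa : IsSelfAdjoint c) (hc2 : c ^ 2 = π 1)
    (hb : π b = c * π a + z) (x : B) : spectralRadius ℂ ⁅a, x⁆ = spectralRadius ℂ ⁅b, x⁆ := by
  have hlie : π ⁅b, x⁆ = c * π ⁅a, x⁆ := by
    rw [Ring.lie_def, Ring.lie_def, map_sub, map_mul, map_mul, hb, map_sub, map_mul, map_mul,
      add_mul, mul_add, (hz x).eq, ← mul_assoc (π x) c, ← (hc x).eq]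
    noncomm_ring
  have hnorm : ∀ t, ‖c * π t‖ = ‖π t‖ := by
    intro t
    have : star (c * π t) * (c * π t) = star (π t) * π t := by
      rw [star_mul, hcsa.star_eq, mul_assoc, ← mul_assoc c c, ← pow_two, hc2, ← map_mul, one_mul]
    have h := congr(‖$this‖)
    rw [CStarRing.norm_star_mul_self, CStarRing.norm_star_mul_self] at h
    exact (mul_self_inj (norm_nonneg _) (norm_nonneg _)).1 h
  have hnorm' : ∀ (n : ℕ) t, ‖c ^ n * π t‖ = ‖π t‖ := by
    intro n t
    have : c ^ n * π t = π t ∨ c ^ n * π t = c * π t := by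
      induction n with
      | zero => simp
      | succ n ih =>
        rw [pow_succ', mul_assoc]
        rcases ih with ih | ih
        · exact .inr (by rw [ih])
        · left
          rw [ih, ← mul_assoc, ← pow_two, hc2, ← map_mul, one_mul]
    rcases this with h | h
    · rw [h]
    · rw [h, hnorm]
  have hpow : ∀ n : ℕ, π (⁅b, x⁆ ^ (n + 1)) = c ^ (n + 1) * π (⁅a, x⁆ ^ (n + 1)) := by
    intro n
    induction n with
    | zero => simpa using hlie
    | succ n ih =>
      rw [pow_succ, map_mul, ih, hlie, pow_succ ⁅a, x⁆ (n + 1), map_mul, pow_succ c (n + 1),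
        mul_assoc, mul_assoc, ← mul_assoc _ c, ← (hc _).eq, mul_assoc]
  have hn : ∀ n : ℕ, ‖⁅a, x⁆ ^ n‖₊ = ‖⁅b, x⁆ ^ n‖₊ := by
    intro n
    rcases n with _ | n
    · simp
    · rw [← NNReal.coe_inj, coe_nnnorm, coe_nnnorm, ← NonUnitalStarAlgHom.norm_map π hπ,
        ← NonUnitalStarAlgHom.norm_map π hπ (⁅b, x⁆ ^ _), hpow, hnorm']
  refine tendsto_nhds_unique (spectrum.pow_nnnorm_pow_one_div_tendsto_nhds_spectralRadius ⁅a, x⁆) ?_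
  simp only [hn]
  exact spectrum.pow_nnnorm_pow_one_div_tendsto_nhds_spectralRadius ⁅b, x⁆

/-- A commutator of selfadjoint elements is normal, so its norm is its spectral radius. -/
lemma spectralRadius_lie_eq_nnnorm {B : Type*} [CStarAlgebra B] {a x : B} (ha : IsSelfAdjoint a)
    (hx : IsSelfAdjoint x) : spectralRadius ℂ ⁅a, x⁆ = ‖⁅a, x⁆‖₊ := by
  have h : star ⁅a, x⁆ = -⁅a, x⁆ := by simp [Ring.lie_def, ha.star_eq, hx.star_eq]
  have : IsStarNormal ⁅a, x⁆ := ⟨by rw [h]; exact (Commute.refl _).neg_left⟩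
  exact IsStarNormal.spectralRadius_eq_nnnorm _

/-- `B` is a unital C*-algebra acting on the Hilbert space `H` through the faithful
representation `π`; the identity of `B` need not act as the identity operator, and the identity of
the weak* closure of `π(B)` is `π 1`. -/
theorem theorem5p4 {B : Type*} [CStarAlgebra B]
    {H : Type*} [NormedAddCommGroup H] [InnerProductSpace ℂ H] [CompleteSpace H]
    (π : B →⋆ₙₐ[ℂ] (H →L[ℂ] H)) (hπ : Function.Injective π)
    (a b : B) (ha : IsSelfAdjoint a) (hb : IsSelfAdjoint b) :
    [ ∀ x : B, spectralRadius ℂ ⁅a, x⁆ = spectralRadius ℂ ⁅b, x⁆,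
      ∀ x : B, IsSelfAdjoint x → ‖⁅a, x⁆‖ = ‖⁅b, x⁆‖,
      ∀ P : Ideal B, IsPrimitiveIdeal P →
        (∃ μ : ℂ, a + b - algebraMap ℂ B μ ∈ P) ∨ (∃ μ : ℂ, a - b - algebraMap ℂ B μ ∈ P),
      ∃ c z : H →L[ℂ] H,
        (c ∈ weakStarClosure (Set.range π) ∧
          c ∈ Set.centralizer (weakStarClosure (Set.range π))) ∧
        (z ∈ weakStarClosure (Set.range π) ∧
          z ∈ Set.centralizer (weakStarClosure (Set.range π))) ∧
        IsSelfAdjoint c ∧ IsSelfAdjoint z ∧ c ^ 2 = π 1 ∧ π b = c * π a + z ].TFAE := by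
  tfae_have 1 → 2 := fun h x hx => by
    have := h x
    rw [spectralRadius_lie_eq_nnnorm ha hx, spectralRadius_lie_eq_nnnorm hb hx] at this
    exact congr_arg NNReal.toReal (ENNReal.coe_injective this)
  tfae_have 2 → 3 := fun h P hP => scalar_mod_primitive ha hb h hP
  tfae_have 3 → 4 := fun h => exists_symmetry π ha hb (lie_mul_mul_lie_eq_zero h)
    (lie_mul_mul_lie_eq_zero fun P hP => (h P hP).symm)
  tfae_have 4 → 1 := by
    rintro ⟨c, z, ⟨-, hc⟩, ⟨-, hz⟩, hcsa, -, hc2, hbz⟩ x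
    let _ : TopologicalSpace (H →L[ℂ] H) := weakStarTopology H
    have hmem : ∀ t, π t ∈ weakStarClosure (Set.range π) := fun t => subset_closure ⟨t, rfl⟩
    exact spectralRadius_lie_eq π hπ (fun t => (hc _ (hmem t)).symm) (fun t => (hz _ (hmem t)).symm)
      hcsa hc2 hbz x
  tfae_finish
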